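/- **Setting.** In each slot $t=1,\dots,T$ an ad query $(v_t,x_t,q_t)$ is drawn i.i.d. from a distribution $\mathcal D$. Here $v_t\in[0,1]$ is the value, $x_t:[0,\infty)\to[0,1]$ is a non-decreasing allocation function with $x_t(0)=0$, and $q_t:[0,\infty)\to[0,1]$ is a non-decreasing payment function with $q_t(b)\le b$ and with $q_t(b)=0$ whenever $x_t(b)=0$; the expected payment is $p_t(b)=q_t(b)x_t(b)$. A (possibly randomized) online algorithm $\mathcal A$, which may know $T$ but not $\mathcal D$, chooses in slot $t$ a bid $b_t\ge 0$ depending on its internal randomness, on the past observations $(v_\tau,x_\tau(b_\tau),p_\tau(b_\tau))_{\tau<t}$ and on $v_t$. Put $$V_{\mathcal A}(\mathcal D,T)=\mathbb E\Big[\sum_{t=1}^T v_t x_t(b_t)\Big].$$ The algorithm satisfies the return-on-spend constraint (ROSC) under $\mathcal D$ if $$\mathbb E\Big[\sum_{t=1}^T p_t(b_t)\Big]\le \mathbb E\Big[\sum_{t=1}^T v_t x_t(b_t)\Big].$$ Let $V_{\mathsf{OPT}}(\mathcal D,T)$ be the supremum of $V_{\mathcal B}(\mathcal D,T)$ over all online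 algorithms $\mathcal B$ (which may be tailored to $\mathcal D$) that satisfy the ROSC under $\mathcal D$. For a class $\mathcal C$ of distributions let $$\mathcal R^{\mathcal C}_{\mathcal A}(T)=\sup_{\mathcal D\in\mathcal C}\big(V_{\mathsf{OPT}}(\mathcal D,T)-V_{\mathcal A}(\mathcal D,T)\big),$$ and write $\mathcal R_{\mathcal A}(T)$ when $\mathcal C$ consists of all distributions. **Theorem.** There is an absolute constant $c>0$ such that for every $T\ge1$ and every online algorithm $\mathcal A$: 1. if $\mathcal A$ satisfies the ROSC over horizon $T$ under every distribution $\mathcal D$, then $\mathcal R_{\mathcal A}(T)\ge cT$; that is, the regret of every online algorithm that strictly satisfies the ROSC is $\Omega(T)$; 2. the same holds within structured inputs: let $\mathcal C$ be the class of distributions for which $v_t\in\{0.5,0.9\}$ with probability $1/2$ each, the functions are almost surely of threshold type, $x_t(b)=\mathbf 1[b\ge\theta_t]$ and $p_t(b)=\theta_t\mathbf 1[b\ge\theta_t]$ for a random threshold $\theta_t\in(0,1]$, and hence satisfy Myerson's condition $p_t(b)=b\,x_t(b)-\int_0^b x_t(u)\,du$; if $\mathcal A$ satisfies the ROSC over horizon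 $T$ under every $\mathcal D\in\mathcal C$, then $\mathcal R^{\mathcal C}_{\mathcal A}(T)\ge cT$. -/

import Mathlib

open MeasureTheory
open scoped NNReal

noncomputable section

namespace AutoBidding

/-- The distribution `𝒟` of one ad query `(v, x, q)`, given as a random query on a probability
space: value `v ∈ [0,1]`, allocation function `x : [0,∞) → [0,1]` and payment function
`q : [0,∞) → [0,1]`. Measurability of `x` and `q` is joint in the outcome and the bid. -/
structure Input where
  Ω : Type
  mΩ : MeasurableSpace Ω
  P : Measure Ω
  isProb : IsProbabilityMeasure P
  v : Ω → ℝ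
  x : Ω → ℝ≥0 → ℝ
  q : Ω → ℝ≥0 → ℝ
  measurable_v : Measurable v
  measurable_x : Measurable (fun z : Ω × ℝ≥0 => x z.1 z.2)
  measurable_q : Measurable (fun z : Ω × ℝ≥0 => q z.1 z.2)
  v_mem : ∀ ω, v ω ∈ Set.Icc (0 : ℝ) 1
  x_mem : ∀ ω b, x ω b ∈ Set.Icc (0 : ℝ) 1
  x_mono : ∀ ω, Monotone (x ω)
  x_zero : ∀ ω, x ω 0 = 0
  q_mem : ∀ ω b, q ω b ∈ Set.Icc (0 : ℝ) 1
  q_mono : ∀ ω, Monotone (q ω)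
  q_eq_zero : ∀ ω b, x ω b = 0 → q ω b = 0
  q_le_bid : ∀ ω b, q ω b ≤ b

attribute [instance] Input.mΩ
attribute [instance] Input.isProb

/-- The expected payment function `p(b) = q(b) x(b)`. -/
def Input.p (D : Input) (ω : D.Ω) (b : ℝ≥0) : ℝ := D.q ω b * D.x ω b

/-- What is observed in a slot: `(v_t, x_t(b_t), p_t(b_t))`. -/
abbrev Obs : Type := ℝ × ℝ × ℝ

/-- A (possibly randomized) online algorithm. Slots are numbered `0, 1, 2, …`. The bid in slot `t`
depends on the private random seed, on the observations of slots `0, …, t-1`, and on the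
present value `v_t`. -/
structure OnlineAlgorithm where
  Seed : Type
  mSeed : MeasurableSpace Seed
  seedLaw : Measure Seed
  isProb : IsProbabilityMeasure seedLaw
  bid : (t : ℕ) → Seed → (Fin t → Obs) → ℝ → ℝ≥0
  measurable_bid : ∀ t : ℕ,
    Measurable (fun z : Seed × (Fin t → Obs) × ℝ => bid t z.1 z.2.1 z.2.2)

attribute [instance] OnlineAlgorithm.mSeed
attribute [instance] OnlineAlgorithm.isProb

namespace OnlineAlgorithm

/-- The observations made in slots `0, …, t-1` when the algorithm runs with seed `s` on the queries
`ω 0, ω 1, …`. -/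
def history (A : OnlineAlgorithm) (D : Input) (s : A.Seed) (ω : ℕ → D.Ω) :
    (t : ℕ) → (Fin t → Obs)
  | 0 => Fin.elim0
  | t + 1 =>
    Fin.snoc (α := fun _ => Obs) (A.history D s ω t)
      (D.v (ω t),
        D.x (ω t) (A.bid t s (A.history D s ω t) (D.v (ω t))),
        D.p (ω t) (A.bid t s (A.history D s ω t) (D.v (ω t))))

/-- The bid `b_t` made in slot `t`. -/
def bidAt (A : OnlineAlgorithm) (D : Input) (s : A.Seed) (ω : ℕ → D.Ω) (t : ℕ) : ℝ≥0 :=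
  A.bid t s (A.history D s ω t) (D.v (ω t))

/-- The joint law of the seed and of the i.i.d. sequence of queries with distribution `D`. -/
def law (A : OnlineAlgorithm) (D : Input) : Measure (A.Seed × (ℕ → D.Ω)) :=
  A.seedLaw.prod (Measure.infinitePi (fun _ : ℕ => D.P))

/-- The total expected accrued valuation `V_A(T) = 𝔼 ∑_{t} v_t x_t(b_t)`. -/
def totalValue (A : OnlineAlgorithm) (D : Input) (T : ℕ) : ℝ :=
  ∫ z, ∑ t ∈ Finset.range T, D.v (z.2 t) * D.x (z.2 t) (A.bidAt D z.1 z.2 t) ∂(A.law D)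

/-- The total expected payment `𝔼 ∑_{t} p_t(b_t)`. -/
def totalPayment (A : OnlineAlgorithm) (D : Input) (T : ℕ) : ℝ :=
  ∫ z, ∑ t ∈ Finset.range T, D.p (z.2 t) (A.bidAt D z.1 z.2 t) ∂(A.law D)

/-- The return-on-spend constraint over horizon `T` under the input distribution `D`. -/
def SatisfiesROSC (A : OnlineAlgorithm) (D : Input) (T : ℕ) : Prop :=
  A.totalPayment D T ≤ A.totalValue D T

end OnlineAlgorithm

/-- The benchmark `V_OPT(T)`: the optimal value over all algorithms that satisfy the constraint
under `D`; since `D` is fixed here, these may be tailored to `D`. -/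
def optValue (D : Input) (T : ℕ) : ℝ :=
  sSup {r : ℝ | ∃ B : OnlineAlgorithm, B.SatisfiesROSC D T ∧ r = B.totalValue D T}

/-- The regret of `A` over horizon `T`, the worst case being taken over the input distributions
in the class `𝒞`. -/
def regret (𝒞 : Set Input) (A : OnlineAlgorithm) (T : ℕ) : ℝ :=
  sSup {r : ℝ | ∃ D ∈ 𝒞, r = optValue D T - A.totalValue D T}

/-- Threshold type: there is a random threshold `θ ∈ (0,1]` such that a bid `b` wins iff `b ≥ θ`,
and then pays `θ`. -/
def Input.IsThreshold (D : Input) : Prop :=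
  ∃ θ : D.Ω → ℝ≥0, Measurable θ ∧ ∀ᵐ ω ∂D.P, 0 < θ ω ∧ θ ω ≤ 1 ∧ ∀ b : ℝ≥0,
    D.x ω b = (if θ ω ≤ b then 1 else 0) ∧
    D.p ω b = (if θ ω ≤ b then (θ ω : ℝ) else 0)

/-- Myerson's condition `p(b) = b x(b) - ∫_0^b x(u) du`. -/
def Input.IsMyerson (D : Input) : Prop :=
  ∀ᵐ ω ∂D.P, ∀ b : ℝ≥0,
    D.p ω b = b * D.x ω b - ∫ u in (0 : ℝ)..b, D.x ω u.toNNReal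

/-- The value is `0.5` or `0.9`, each with probability `1/2`. -/
def Input.IsTwoValued (D : Input) : Prop :=
  D.P {ω | D.v ω = 1 / 2} = 1 / 2 ∧ D.P {ω | D.v ω = 9 / 10} = 1 / 2

/-- Threshold inputs that satisfy Myerson's condition and have the two values `0.5` and `0.9`. -/
def structuredInputs : Set Input :=
  {D | D.IsThreshold ∧ D.IsMyerson ∧ D.IsTwoValued}

end AutoBidding

end

open MeasureTheory
open scoped NNReal

noncomputable section

namespace AutoBidding

/-! ### Runs of an algorithm: measurability, integrability, expectations -/

namespace OnlineAlgorithm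

variable (A : OnlineAlgorithm) (D : Input)

/-! Two structured inputs share one query law and differ only in the threshold of a rare kind of
high-value query, of probability `1 / (4 * T)`: it is `9 / 10` in the first and `1 / 10` in the
second. Low-value queries cost `2 / (5 * T)` more than they are worth. In the first input no query
yields a surplus, so the constraint forces every slot to break even, and low values are a.s. never
won (`SatisfiesROSC.ae_slotPayment_eq`). Until a rare query occurs the two runs coincide
(`history_hardInput_eq`). Over `T` slots one occurs with probability at most `1 / 4`, so in the
second input the value is at most `(9/20 + 1/2 * 1/4) * T = 23/40 * T`. Yet there, always bidding
`1` is feasible: the expected loss on low values, `T * 1/2 * 2 / (5 * T) = 1/5`, equals the expected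
surplus `T * 1 / (4 * T) * 8/10`. Its value is `7/10 * T`, which leaves a gap of `T / 8`. -/

instance isProbabilityMeasure_law : IsProbabilityMeasure (A.law D) := by
  unfold law; infer_instance

/-- A bid depends on the history before it and the next history on that bid, so both go through one
induction. -/
theorem measurable_history_and_bidAt (t : ℕ) :
    Measurable (fun z : A.Seed × (ℕ → D.Ω) => A.history D z.1 z.2 t) ∧
      Measurable (fun z : A.Seed × (ℕ → D.Ω) => A.bidAt D z.1 z.2 t) := by
  have bid_of_history (t : ℕ)
      (h : Measurable (fun z : A.Seed × (ℕ → D.Ω) => A.history D z.1 z.2 t)) :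
      Measurable (fun z : A.Seed × (ℕ → D.Ω) => A.bidAt D z.1 z.2 t) := by
    have hv : Measurable (fun z : A.Seed × (ℕ → D.Ω) => D.v (z.2 t)) :=
      D.measurable_v.comp ((measurable_pi_apply t).comp measurable_snd)
    exact (A.measurable_bid t).comp (measurable_fst.prodMk (h.prodMk hv))
  induction t with
  | zero =>
    have h : Measurable (fun z : A.Seed × (ℕ → D.Ω) => A.history D z.1 z.2 0) :=
      measurable_pi_lambda _ fun i => i.elim0
    exact ⟨h, bid_of_history 0 h⟩
  | succ t ih =>
    have hω : Measurable (fun z : A.Seed × (ℕ → D.Ω) => z.2 t) :=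
      (measurable_pi_apply t).comp measurable_snd
    have hv := D.measurable_v.comp hω
    have hx := D.measurable_x.comp (hω.prodMk ih.2)
    have hq := D.measurable_q.comp (hω.prodMk ih.2)
    have h : Measurable (fun z : A.Seed × (ℕ → D.Ω) => A.history D z.1 z.2 (t + 1)) := by
      refine measurable_pi_lambda _ fun i => ?_
      refine Fin.lastCases ?_ (fun j => ?_) i
      · simp only [history, Fin.snoc_last]
        exact hv.prodMk (hx.prodMk (hq.mul hx))
      · simp only [history, Fin.snoc_castSucc]
        exact (measurable_pi_apply j).comp ih.1
    exact ⟨h, bid_of_history _ h⟩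

/-- The value accrued in slot `t`. -/
def slotValue (z : A.Seed × (ℕ → D.Ω)) (t : ℕ) : ℝ :=
  D.v (z.2 t) * D.x (z.2 t) (A.bidAt D z.1 z.2 t)

/-- The payment made in slot `t`. -/
def slotPayment (z : A.Seed × (ℕ → D.Ω)) (t : ℕ) : ℝ :=
  D.p (z.2 t) (A.bidAt D z.1 z.2 t)

theorem slotValue_mem (z : A.Seed × (ℕ → D.Ω)) (t : ℕ) :
    A.slotValue D z t ∈ Set.Icc (0 : ℝ) 1 :=
  ⟨mul_nonneg (D.v_mem _).1 (D.x_mem _ _).1,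
    mul_le_one₀ (D.v_mem _).2 (D.x_mem _ _).1 (D.x_mem _ _).2⟩

theorem slotPayment_mem (z : A.Seed × (ℕ → D.Ω)) (t : ℕ) :
    A.slotPayment D z t ∈ Set.Icc (0 : ℝ) 1 :=
  ⟨mul_nonneg (D.q_mem _ _).1 (D.x_mem _ _).1,
    mul_le_one₀ (D.q_mem _ _).2 (D.x_mem _ _).1 (D.x_mem _ _).2⟩

theorem integrable_slotValue (t : ℕ) :
    Integrable (fun z => A.slotValue D z t) (A.law D) := by
  have hω : Measurable (fun z : A.Seed × (ℕ → D.Ω) => z.2 t) :=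
    (measurable_pi_apply t).comp measurable_snd
  have hm : Measurable (fun z => A.slotValue D z t) :=
    (D.measurable_v.comp hω).mul
      (D.measurable_x.comp (hω.prodMk (A.measurable_history_and_bidAt D t).2))
  refine .of_bound hm.aestronglyMeasurable 1 (.of_forall fun z => ?_)
  rw [Real.norm_of_nonneg (A.slotValue_mem D z t).1]
  exact (A.slotValue_mem D z t).2

theorem integrable_slotPayment (t : ℕ) :
    Integrable (fun z => A.slotPayment D z t) (A.law D) := by
  have hω : Measurable (fun z : A.Seed × (ℕ → D.Ω) => z.2 t) :=
    (measurable_pi_apply t).comp measurable_snd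
  have hb := hω.prodMk (A.measurable_history_and_bidAt D t).2
  have hm : Measurable (fun z => A.slotPayment D z t) :=
    (D.measurable_q.comp hb).mul (D.measurable_x.comp hb)
  refine .of_bound hm.aestronglyMeasurable 1 (.of_forall fun z => ?_)
  rw [Real.norm_of_nonneg (A.slotPayment_mem D z t).1]
  exact (A.slotPayment_mem D z t).2

theorem totalValue_nonneg (T : ℕ) : 0 ≤ A.totalValue D T :=
  integral_nonneg fun z => Finset.sum_nonneg fun t _ => (A.slotValue_mem D z t).1

theorem totalValue_le (T : ℕ) : A.totalValue D T ≤ T := by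
  have h : A.totalValue D T ≤ ∫ _, (T : ℝ) ∂(A.law D) := by
    refine integral_mono (integrable_finsetSum _ fun t _ => A.integrable_slotValue D t)
      (integrable_const _) fun z => ?_
    refine (Finset.sum_le_card_nsmul _ _ 1 fun t _ => (A.slotValue_mem D z t).2).trans ?_
    simp
  simpa using h

theorem measurePreserving_query (t : ℕ) :
    MeasurePreserving (fun z : A.Seed × (ℕ → D.Ω) => z.2 t) (A.law D) D.P :=
  (measurePreserving_eval_infinitePi (fun _ : ℕ => D.P) t).comp measurePreserving_snd

theorem integrable_sum_query {f : D.Ω → ℝ} (hf : Integrable f D.P) (T : ℕ) :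
    Integrable (fun z => ∑ t ∈ Finset.range T, f (z.2 t)) (A.law D) :=
  integrable_finsetSum _ fun t _ => (A.measurePreserving_query D t).integrable_comp_of_integrable hf

theorem integral_sum_query {f : D.Ω → ℝ} (hf : Integrable f D.P) (T : ℕ) :
    ∫ z, ∑ t ∈ Finset.range T, f (z.2 t) ∂(A.law D) = T * ∫ ω, f ω ∂D.P := by
  have hi (t : ℕ) : Integrable (fun z : A.Seed × (ℕ → D.Ω) => f (z.2 t)) (A.law D) :=
    (A.measurePreserving_query D t).integrable_comp_of_integrable hf
  rw [integral_finsetSum _ fun t _ => hi t]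
  have h (t : ℕ) : ∫ z, f (z.2 t) ∂(A.law D) = ∫ ω, f ω ∂D.P := by
    rw [← (A.measurePreserving_query D t).map_eq, integral_map]
    · exact (A.measurePreserving_query D t).measurable.aemeasurable
    · rw [(A.measurePreserving_query D t).map_eq]; exact hf.aestronglyMeasurable
  simp [h]

/-- If no slot can yield a surplus, an algorithm satisfying the constraint a.s. breaks even in
every slot. -/
theorem SatisfiesROSC.ae_slotPayment_eq {A : OnlineAlgorithm} {D : Input} {T : ℕ}
    (h : A.SatisfiesROSC D T) (hle : ∀ z t, A.slotValue D z t ≤ A.slotPayment D z t) :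
    ∀ᵐ z ∂(A.law D), ∀ t ∈ Finset.range T, A.slotPayment D z t = A.slotValue D z t := by
  have hV : Integrable (fun z => ∑ t ∈ Finset.range T, A.slotValue D z t) (A.law D) :=
    integrable_finsetSum _ fun t _ => A.integrable_slotValue D t
  have hP : Integrable (fun z => ∑ t ∈ Finset.range T, A.slotPayment D z t) (A.law D) :=
    integrable_finsetSum _ fun t _ => A.integrable_slotPayment D t
  have hsum (z) : ∑ t ∈ Finset.range T, A.slotValue D z t ≤
      ∑ t ∈ Finset.range T, A.slotPayment D z t := Finset.sum_le_sum fun t _ => hle z t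
  have hnn : 0 ≤ fun z => ∑ t ∈ Finset.range T, A.slotPayment D z t -
      ∑ t ∈ Finset.range T, A.slotValue D z t := fun z => sub_nonneg.2 (hsum z)
  have h0 : ∫ z, (∑ t ∈ Finset.range T, A.slotPayment D z t -
      ∑ t ∈ Finset.range T, A.slotValue D z t) ∂(A.law D) = 0 := by
    refine le_antisymm ?_ (integral_nonneg hnn)
    rw [integral_sub hP hV]
    exact sub_nonpos.2 h
  filter_upwards [(integral_eq_zero_iff_of_nonneg hnn (hP.sub hV)).1 h0] with z hz t ht
  -- Equal sums of termwise ordered terms are termwise equal.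
  have := (Finset.sum_eq_sum_iff_of_le fun t _ => hle z t).1 (sub_eq_zero.1 hz).symm
  exact (this t ht).symm

/-- The algorithm that always bids `b`. -/
def constantBid (b : ℝ≥0) : OnlineAlgorithm where
  Seed := Unit
  mSeed := inferInstance
  seedLaw := Measure.dirac ()
  isProb := inferInstance
  bid _ _ _ _ := b
  measurable_bid _ := measurable_const

end OnlineAlgorithm

/-! ### Bounds for the benchmark and the regret -/

/-- The real `sSup` is a genuine supremum only for a set bounded above; here `T` bounds it. -/
theorem totalValue_le_optValue {B : OnlineAlgorithm} {D : Input} {T : ℕ}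
    (h : B.SatisfiesROSC D T) : B.totalValue D T ≤ optValue D T := by
  refine le_csSup ⟨T, ?_⟩ ⟨B, h, rfl⟩
  rintro _ ⟨B, -, rfl⟩
  exact B.totalValue_le D T

theorem optValue_le (D : Input) (T : ℕ) : optValue D T ≤ T := by
  refine Real.sSup_le ?_ T.cast_nonneg
  rintro _ ⟨B, -, rfl⟩
  exact B.totalValue_le D T

theorem le_regret {𝒞 : Set Input} {D : Input} (hD : D ∈ 𝒞) (A : OnlineAlgorithm) (T : ℕ) :
    optValue D T - A.totalValue D T ≤ regret 𝒞 A T := by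
  refine le_csSup ⟨T, ?_⟩ ⟨D, hD, rfl⟩
  rintro _ ⟨D, -, rfl⟩
  linarith [optValue_le D T, A.totalValue_nonneg D T]

/-! ### Threshold queries and Myerson's condition -/

/-- The query with value `v ω` and winning threshold `θ ω`, for `ω` distributed as `P`. -/
def thresholdInput {Ω : Type} [mΩ : MeasurableSpace Ω] (P : Measure Ω)
    [isProb : IsProbabilityMeasure P] (v : Ω → ℝ) (θ : Ω → ℝ≥0) (hv : Measurable v) (hθ : Measurable θ)
    (v_mem : ∀ ω, v ω ∈ Set.Icc (0 : ℝ) 1) (θ_mem : ∀ ω, θ ω ∈ Set.Ioc (0 : ℝ≥0) 1) : Input where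
  Ω := Ω
  mΩ := mΩ
  P := P
  isProb := isProb
  v := v
  x ω b := if θ ω ≤ b then 1 else 0
  q ω b := if θ ω ≤ b then (θ ω : ℝ) else 0
  measurable_v := hv
  measurable_x := Measurable.ite (measurableSet_le (hθ.comp measurable_fst) measurable_snd)
    measurable_const measurable_const
  measurable_q := Measurable.ite (measurableSet_le (hθ.comp measurable_fst) measurable_snd)
    (measurable_coe_nnreal_real.comp (hθ.comp measurable_fst)) measurable_const
  v_mem := v_mem
  x_mem ω b := by split_ifs <;> simp
  x_mono ω b c hbc := by
    dsimp only
    split_ifs with h₁ h₂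
    · exact le_rfl
    · exact absurd (h₁.trans hbc) h₂
    · exact zero_le_one
    · exact le_rfl
  x_zero ω := if_neg (not_le.2 (θ_mem ω).1)
  q_mem ω b := by
    split_ifs
    · exact ⟨(θ ω).2, by exact_mod_cast (θ_mem ω).2⟩
    · simp
  q_mono ω b c hbc := by
    dsimp only
    split_ifs with h₁ h₂
    · exact le_rfl
    · exact absurd (h₁.trans hbc) h₂
    · exact (θ ω).2
    · exact le_rfl
  q_eq_zero ω b h := by
    by_cases h' : θ ω ≤ b <;> simp_all
  q_le_bid ω b := by
    split_ifs with h
    · exact_mod_cast h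
    · exact b.2

/-- Threshold functions satisfy Myerson's condition. -/
theorem myerson_of_threshold (θ b : ℝ≥0) :
    (if θ ≤ b then (θ : ℝ) else 0) = b * (if θ ≤ b then (1 : ℝ) else 0) -
      ∫ u in (0 : ℝ)..b, (if θ ≤ u.toNNReal then (1 : ℝ) else 0) := by
  have hlow (c : ℝ≥0) (hc : c ≤ θ) :
      ∫ u in (0 : ℝ)..c, (if θ ≤ u.toNNReal then (1 : ℝ) else 0) = 0 := by
    refine intervalIntegral.integral_zero_ae ?_
    -- If `c = θ` the integrand is `1` at the endpoint, so it vanishes only almost everywhere.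
    have hne : ∀ᵐ u : ℝ, u ≠ θ := by simp [ae_iff]
    filter_upwards [hne] with u hu hmem
    rw [Set.uIoc_of_le (NNReal.coe_nonneg c)] at hmem
    refine if_neg (not_le.2 ?_)
    rw [Real.toNNReal_lt_iff_lt_coe hmem.1.le]
    exact lt_of_le_of_ne (hmem.2.trans (by exact_mod_cast hc)) hu
  have hmono (c d : ℝ) : IntervalIntegrable
      (fun u : ℝ => if θ ≤ u.toNNReal then (1 : ℝ) else 0) volume c d := by
    refine Monotone.intervalIntegrable fun u w huw => ?_
    have := Real.toNNReal_mono huw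
    split_ifs with h₁ h₂
    · exact le_rfl
    · exact absurd (h₁.trans this) h₂
    · exact zero_le_one
    · exact le_rfl
  split_ifs with h
  · have hhigh : ∫ u in (θ : ℝ)..b, (if θ ≤ u.toNNReal then (1 : ℝ) else 0) = b - θ := by
      rw [intervalIntegral.integral_congr (g := fun _ => (1 : ℝ))]
      · simp
      · intro u hu
        rw [Set.uIcc_of_le (by exact_mod_cast h)] at hu
        exact if_pos (NNReal.le_toNNReal_of_coe_le hu.1)
    rw [← intervalIntegral.integral_add_adjacent_intervals (hmono 0 θ) (hmono θ b),
      hlow θ le_rfl, hhigh]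
    ring
  · rw [hlow b (not_le.1 h).le]
    simp

section thresholdInput

variable {Ω : Type} [MeasurableSpace Ω] (P : Measure Ω) [IsProbabilityMeasure P]
  {v : Ω → ℝ} {θ : Ω → ℝ≥0} (hv : Measurable v) (hθ : Measurable θ)
  (v_mem : ∀ ω, v ω ∈ Set.Icc (0 : ℝ) 1) (θ_mem : ∀ ω, θ ω ∈ Set.Ioc (0 : ℝ≥0) 1)

theorem thresholdInput_p (ω : Ω) (b : ℝ≥0) :
    (thresholdInput P v θ hv hθ v_mem θ_mem).p ω b = if θ ω ≤ b then (θ ω : ℝ) else 0 := by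
  change (if θ ω ≤ b then (θ ω : ℝ) else 0) * (if θ ω ≤ b then (1 : ℝ) else 0) = _
  split_ifs <;> simp

theorem isThreshold_thresholdInput :
    (thresholdInput P v θ hv hθ v_mem θ_mem).IsThreshold :=
  ⟨θ, hθ, .of_forall fun ω => ⟨(θ_mem ω).1, (θ_mem ω).2, fun b =>
    ⟨rfl, thresholdInput_p P hv hθ v_mem θ_mem ω b⟩⟩⟩

theorem isMyerson_thresholdInput :
    (thresholdInput P v θ hv hθ v_mem θ_mem).IsMyerson :=
  .of_forall fun ω b =>
    (thresholdInput_p P hv hθ v_mem θ_mem ω b).trans (myerson_of_threshold (θ ω) b)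

end thresholdInput

/-! ### The pair of hard inputs -/

/-- The probability that a low threshold is offered to a high value. -/
def bargainProb (T : ℕ) : ℝ := 1 / (4 * T)

theorem bargainProb_nonneg (T : ℕ) : 0 ≤ bargainProb T := by unfold bargainProb; positivity

theorem bargainProb_le {T : ℕ} (hT : 1 ≤ T) : bargainProb T ≤ 1 / 4 := by
  have : (1 : ℝ) ≤ T := by exact_mod_cast hT
  unfold bargainProb
  exact one_div_le_one_div_of_le (by norm_num) (by linarith)

/-- The law of the three kinds of query: low value (`0`), high value with a low threshold (`1`),
high value with a threshold equal to the value (`2`). -/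
def queryLaw (T : ℕ) : Measure (Fin 3) :=
  ENNReal.ofReal (1 / 2) • Measure.dirac 0 + ENNReal.ofReal (bargainProb T) • Measure.dirac 1 +
    ENNReal.ofReal (1 / 2 - bargainProb T) • Measure.dirac 2

theorem integral_queryLaw {T : ℕ} (hT : 1 ≤ T) (f : Fin 3 → ℝ) :
    ∫ ω, f ω ∂(queryLaw T) =
      1 / 2 * f 0 + bargainProb T * f 1 + (1 / 2 - bargainProb T) * f 2 := by
  have hi (i : Fin 3) (r : ℝ) : Integrable f (ENNReal.ofReal r • Measure.dirac i) :=
    (integrable_dirac (by simp)).smul_measure ENNReal.ofReal_ne_top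
  have h := bargainProb_le hT
  rw [queryLaw, integral_add_measure ((hi _ _).add_measure (hi _ _)) (hi _ _),
    integral_add_measure (hi _ _) (hi _ _)]
  simp only [integral_smul_measure, integral_dirac, smul_eq_mul]
  rw [ENNReal.toReal_ofReal (by norm_num), ENNReal.toReal_ofReal (bargainProb_nonneg T),
    ENNReal.toReal_ofReal (by linarith)]

theorem isProbabilityMeasure_queryLaw {T : ℕ} (hT : 1 ≤ T) :
    IsProbabilityMeasure (queryLaw T) := by
  have h := bargainProb_le hT
  have h' := bargainProb_nonneg T
  constructor
  simp only [queryLaw, Measure.add_apply, Measure.smul_apply, measure_univ, smul_eq_mul, mul_one]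
  rw [← ENNReal.ofReal_add (by norm_num) h', ← ENNReal.ofReal_add (by linarith) (by linarith)]
  norm_num

/-- The values of the three kinds of query. -/
def queryValue : Fin 3 → ℝ := ![1 / 2, 9 / 10, 9 / 10]

/-- The thresholds of the three kinds of query, with threshold `β` in place of the low one. -/
def queryThreshold (T : ℕ) (β : ℝ≥0) : Fin 3 → ℝ≥0 := ![1 / 2 + 2 / (5 * T), β, 9 / 10]

theorem queryValue_mem (ω : Fin 3) : queryValue ω ∈ Set.Icc (0 : ℝ) 1 := by
  fin_cases ω <;> norm_num [queryValue]

theorem queryThreshold_mem {T : ℕ} (hT : 1 ≤ T) {β : ℝ≥0} (hβ : β ∈ Set.Ioc (0 : ℝ≥0) 1)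
    (ω : Fin 3) : queryThreshold T β ω ∈ Set.Ioc (0 : ℝ≥0) 1 := by
  fin_cases ω
  · refine ⟨by simp [queryThreshold], ?_⟩
    have h1 : (1 : ℝ) ≤ T := by exact_mod_cast hT
    have : 2 / (5 * (T : ℝ)) ≤ 2 / 5 := by
      apply div_le_div_of_nonneg_left <;> linarith
    rw [← NNReal.coe_le_coe]
    simp only [queryThreshold, Fin.zero_eta, Matrix.cons_val_zero]
    push_cast
    linarith
  · exact hβ
  · simp only [queryThreshold, ← NNReal.coe_le_coe, ← NNReal.coe_lt_coe, Set.mem_Ioc]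
    norm_num

/-- The input whose queries follow `queryLaw T`, with threshold `β` in place of the low one. -/
def hardInput {T : ℕ} (hT : 1 ≤ T) {β : ℝ≥0} (hβ : β ∈ Set.Ioc (0 : ℝ≥0) 1) : Input :=
  @thresholdInput (Fin 3) _ (queryLaw T) (isProbabilityMeasure_queryLaw hT) queryValue
    (queryThreshold T β) (measurable_of_finite _) (measurable_of_finite _) queryValue_mem
    (queryThreshold_mem hT hβ)

section hardInput

variable {T : ℕ} (hT : 1 ≤ T) {β : ℝ≥0} (hβ : β ∈ Set.Ioc (0 : ℝ≥0) 1)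

theorem hardInput_mem_structuredInputs : hardInput hT hβ ∈ structuredInputs := by
  have := isProbabilityMeasure_queryLaw hT
  have h := bargainProb_le hT
  have h' := bargainProb_nonneg T
  refine ⟨isThreshold_thresholdInput _ _ _ _ _, isMyerson_thresholdInput _ _ _ _ _, ?_, ?_⟩
  · change queryLaw T {ω | queryValue ω = 1 / 2} = 1 / 2
    have hs : {ω | queryValue ω = 1 / 2} = {0} := by
      ext ω; fin_cases ω <;> norm_num [queryValue]
    rw [hs]
    simp [queryLaw]
  · change queryLaw T {ω | queryValue ω = 9 / 10} = 1 / 2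
    have hs : {ω | queryValue ω = 9 / 10} = {1, 2} := by
      ext ω; fin_cases ω <;> norm_num [queryValue, Fin.ext_iff]
    rw [hs]
    have : ENNReal.ofReal (bargainProb T) + ENNReal.ofReal (1 / 2 - bargainProb T) = 1 / 2 := by
      rw [← ENNReal.ofReal_add h' (by linarith)]
      simp
    simpa [queryLaw] using this

theorem hardInput_p (ω : Fin 3) (b : ℝ≥0) : (hardInput hT hβ).p ω b =
    if queryThreshold T β ω ≤ b then (queryThreshold T β ω : ℝ) else 0 :=
  @thresholdInput_p _ _ _ (isProbabilityMeasure_queryLaw hT) _ _ _ _ _ _ ω b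

theorem integral_hardInput (f : Fin 3 → ℝ) : ∫ ω, f ω ∂(hardInput hT hβ).P =
    1 / 2 * f 0 + bargainProb T * f 1 + (1 / 2 - bargainProb T) * f 2 :=
  integral_queryLaw hT f

theorem integrable_hardInput (f : Fin 3 → ℝ) : Integrable f (hardInput hT hβ).P :=
  have := isProbabilityMeasure_queryLaw hT
  show Integrable f (queryLaw T) from .of_finite

/-! ### The benchmark that wins every query -/

theorem totalValue_constantBid :
    (OnlineAlgorithm.constantBid 1).totalValue (hardInput hT hβ) T = 7 / 10 * T := by
  have h (ω : Fin 3) : (hardInput hT hβ).x ω 1 = 1 := if_pos (queryThreshold_mem hT hβ ω).2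
  have hs := (OnlineAlgorithm.constantBid 1).integral_sum_query (hardInput hT hβ)
    (integrable_hardInput hT hβ queryValue) T
  rw [integral_hardInput] at hs
  refine Eq.trans (integral_congr_ae (.of_forall fun z => ?_)) (hs.trans ?_)
  · refine Finset.sum_congr rfl fun t _ => ?_
    exact (congrArg _ (h _)).trans (mul_one _)
  · simp [queryValue]; ring

/-- Relative to the value, `1 / 5` is the total expected overpayment on low values and `1 / 4` the
expected number of rare queries; at `β = 1 / 10` the two corrections cancel. -/
theorem totalPayment_constantBid :
    (OnlineAlgorithm.constantBid 1).totalPayment (hardInput hT hβ) T =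
      7 / 10 * T + 1 / 5 + 1 / 4 * (β - 9 / 10) := by
  have h (ω : Fin 3) : (hardInput hT hβ).p ω 1 = queryThreshold T β ω :=
    (hardInput_p hT hβ ω 1).trans (if_pos (queryThreshold_mem hT hβ ω).2)
  have hs := (OnlineAlgorithm.constantBid 1).integral_sum_query (hardInput hT hβ)
    (integrable_hardInput hT hβ fun ω => (queryThreshold T β ω : ℝ)) T
  rw [integral_hardInput hT hβ fun ω => (queryThreshold T β ω : ℝ)] at hs
  refine Eq.trans (integral_congr_ae (.of_forall fun z => ?_)) (hs.trans ?_)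
  · exact Finset.sum_congr rfl fun t _ => h _
  · have : (T : ℝ) ≠ 0 := by positivity
    simp [queryThreshold, bargainProb]
    field_simp
    ring

/-! ### Coupling the two inputs -/

theorem slotValue_hardInput (A : OnlineAlgorithm) (z : A.Seed × (ℕ → Fin 3)) (t : ℕ) :
    A.slotValue (hardInput hT hβ) z t =
      if queryThreshold T β (z.2 t) ≤ A.bidAt (hardInput hT hβ) z.1 z.2 t
      then queryValue (z.2 t) else 0 := by
  change queryValue (z.2 t) * (if _ then (1 : ℝ) else 0) = _
  rw [mul_ite, mul_one, mul_zero]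

theorem slotPayment_hardInput (A : OnlineAlgorithm) (z : A.Seed × (ℕ → Fin 3)) (t : ℕ) :
    A.slotPayment (hardInput hT hβ) z t =
      if queryThreshold T β (z.2 t) ≤ A.bidAt (hardInput hT hβ) z.1 z.2 t
      then (queryThreshold T β (z.2 t) : ℝ) else 0 :=
  hardInput_p hT hβ _ _

/-- The low threshold cannot be noticed before it occurs. -/
theorem history_hardInput_eq {γ : ℝ≥0} (hγ : γ ∈ Set.Ioc (0 : ℝ≥0) 1) (A : OnlineAlgorithm)
    (s : A.Seed) (ω : ℕ → Fin 3) (t : ℕ) (h : ∀ τ < t, ω τ ≠ 1) :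
    A.history (hardInput hT hβ) s ω t = A.history (hardInput hT hγ) s ω t := by
  have hθ (i : Fin 3) (hi : i ≠ 1) : queryThreshold T β i = queryThreshold T γ i := by
    fin_cases i
    · rfl
    · exact absurd rfl hi
    · rfl
  induction t with
  | zero => rfl
  | succ t ih =>
    have hx (b : ℝ≥0) : (hardInput hT hβ).x (ω t) b = (hardInput hT hγ).x (ω t) b := by
      change (if _ then (1 : ℝ) else 0) = if _ then (1 : ℝ) else 0
      rw [hθ _ (h t t.lt_succ_self)]
    have hp (b : ℝ≥0) : (hardInput hT hβ).p (ω t) b = (hardInput hT hγ).p (ω t) b := by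
      rw [hardInput_p, hardInput_p, hθ _ (h t t.lt_succ_self)]
    have hv : (hardInput hT hβ).v (ω t) = (hardInput hT hγ).v (ω t) := rfl
    simp only [OnlineAlgorithm.history]
    rw [ih fun τ hτ => h τ (hτ.trans t.lt_succ_self), hx, hp, hv]

/-- If the constraint holds when there is no surplus to be earned, then low-value queries are
a.s. not won unless a low threshold occurs. -/
theorem ae_slotValue_hardInput_le (A : OnlineAlgorithm) {γ : ℝ≥0}
    (hγ : γ ∈ Set.Ioc (0 : ℝ≥0) 1) (hγ' : γ = 9 / 10)
    (h : A.SatisfiesROSC (hardInput hT hγ) T) :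
    ∀ᵐ z ∂(A.law (hardInput hT hβ)), ∀ t ∈ Finset.range T,
      A.slotValue (hardInput hT hβ) z t ≤
        (![0, 9 / 10, 9 / 10] : Fin 3 → ℝ) (z.2 t) +
          1 / 2 * ∑ τ ∈ Finset.range T, (![0, 1, 0] : Fin 3 → ℝ) (z.2 τ) := by
  have hT' : (0 : ℝ) < T := by exact_mod_cast hT
  have hval (i : Fin 3) : queryValue i ≤ queryThreshold T γ i := by
    fin_cases i
    · simp [queryValue, queryThreshold]
      positivity
    · simp [queryValue, queryThreshold, hγ']
    · simp [queryValue, queryThreshold]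
  have hle (z : A.Seed × (ℕ → Fin 3)) (t : ℕ) :
      A.slotValue (hardInput hT hγ) z t ≤ A.slotPayment (hardInput hT hγ) z t := by
    rw [slotValue_hardInput, slotPayment_hardInput]
    split_ifs
    · exact hval _
    · exact le_rfl
  -- The low threshold does not enter the law, so an a.s. statement about one input transfers to the
  -- other on the same outcomes.
  have hlaw : A.law (hardInput hT hγ) = A.law (hardInput hT hβ) := rfl
  have hae := h.ae_slotPayment_eq hle
  rw [hlaw] at hae
  have key (z : A.Seed × (ℕ → Fin 3)) (hz : ∀ t ∈ Finset.range T,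
      A.slotPayment (hardInput hT hγ) z t = A.slotValue (hardInput hT hγ) z t) (t : ℕ)
      (ht : t ∈ Finset.range T) : A.slotValue (hardInput hT hβ) z t ≤
        (![0, 9 / 10, 9 / 10] : Fin 3 → ℝ) (z.2 t) +
          1 / 2 * ∑ τ ∈ Finset.range T, (![0, 1, 0] : Fin 3 → ℝ) (z.2 τ) := by
    have hterm (i : Fin 3) : 0 ≤ (![0, 1, 0] : Fin 3 → ℝ) i := by fin_cases i <;> simp
    have hsum : 0 ≤ ∑ τ ∈ Finset.range T, (![0, 1, 0] : Fin 3 → ℝ) (z.2 τ) :=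
      Finset.sum_nonneg fun τ _ => hterm _
    rw [slotValue_hardInput]
    by_cases h0 : z.2 t = 0
    -- If a rare query occurs in the horizon, the sum is at least `1` and its half pays for the low
    -- value; otherwise the two runs agree.
    · by_cases hb : ∃ τ ∈ Finset.range T, z.2 τ = 1
      · obtain ⟨τ, hτ, hb⟩ := hb
        have := Finset.single_le_sum (fun τ _ => hterm (z.2 τ)) hτ
        simp only [hb, Matrix.cons_val_one, Matrix.cons_val_zero] at this
        rw [h0]
        split_ifs
        · simp only [queryValue, Matrix.cons_val_zero]; linarith
        · simp only [Matrix.cons_val_zero]; linarith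
      · push Not at hb
        have hbid : A.bidAt (hardInput hT hβ) z.1 z.2 t = A.bidAt (hardInput hT hγ) z.1 z.2 t := by
          unfold OnlineAlgorithm.bidAt
          rw [history_hardInput_eq hT hβ hγ A z.1 z.2 t fun τ hτ =>
            hb τ (Finset.mem_range.2 (hτ.trans (Finset.mem_range.1 ht)))]
          rfl
        have hlose := hz t ht
        rw [slotValue_hardInput, slotPayment_hardInput, h0] at hlose
        rw [hbid, h0, if_neg]
        · simp only [Matrix.cons_val_zero]; linarith
        -- Winning a low value would lose `2 / (5 * T)`, against breaking even.
        · intro hwin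
          have hwin' : queryThreshold T γ 0 ≤ A.bidAt (hardInput hT hγ) z.1 z.2 t := hwin
          rw [if_pos hwin', if_pos hwin'] at hlose
          have : (0 : ℝ) < 2 / (5 * T) := by positivity
          simp only [queryThreshold, queryValue, Matrix.cons_val_zero] at hlose
          push_cast at hlose
          linarith
    · have hv : queryValue (z.2 t) = (![0, 9 / 10, 9 / 10] : Fin 3 → ℝ) (z.2 t) ∧
          0 ≤ (![0, 9 / 10, 9 / 10] : Fin 3 → ℝ) (z.2 t) := by
        generalize z.2 t = i at h0
        fin_cases i
        · exact absurd rfl h0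
        · norm_num [queryValue]
        · norm_num [queryValue]
      split_ifs
      · rw [hv.1]; linarith
      · linarith [hv.2]
  filter_upwards [hae] with z hz
  exact key z hz

/-- High values give at most `9/20 * T`. Low values are charged to the number of rare queries, of
mean `1 / 4`, in a union bound that adds `1/8 * T`. -/
theorem totalValue_hardInput_le (A : OnlineAlgorithm) {γ : ℝ≥0}
    (hγ : γ ∈ Set.Ioc (0 : ℝ≥0) 1) (hγ' : γ = 9 / 10)
    (h : A.SatisfiesROSC (hardInput hT hγ) T) :
    A.totalValue (hardInput hT hβ) T ≤ 23 / 40 * T := by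
  -- The rare-query count recurs in the bound for each of the `T` slots; the factor `T` gathers
  -- these copies into a sum of one-query functions.
  let F : Fin 3 → ℝ := fun i => (![0, 9 / 10, 9 / 10] : Fin 3 → ℝ) i +
    T * (1 / 2 * (![0, 1, 0] : Fin 3 → ℝ) i)
  have hF := integrable_hardInput hT hβ F
  have hint := A.integral_sum_query (hardInput hT hβ) hF T
  rw [integral_hardInput] at hint
  have hle : A.totalValue (hardInput hT hβ) T ≤
      ∫ z, ∑ t ∈ Finset.range T, F (z.2 t) ∂(A.law (hardInput hT hβ)) := by
    refine integral_mono_ae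
      (integrable_finsetSum _ fun t _ => A.integrable_slotValue (hardInput hT hβ) t)
      (A.integrable_sum_query _ hF T) ?_
    filter_upwards [ae_slotValue_hardInput_le hT hβ A hγ hγ' h] with z hz
    refine (Finset.sum_le_sum hz).trans (le_of_eq ?_)
    rw [Finset.sum_add_distrib, Finset.sum_const, Finset.card_range, nsmul_eq_mul,
      Finset.sum_add_distrib, Finset.mul_sum, Finset.mul_sum]
  refine hle.trans (le_of_eq (hint.trans ?_))
  have : (T : ℝ) ≠ 0 := by positivity
  simp [F, bargainProb]
  field_simp
  ring

end hardInput

/-! ### The regret gap -/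

theorem structuredInputs_regret_ge {T : ℕ} (hT : 1 ≤ T) (A : OnlineAlgorithm)
    (h : ∀ D ∈ structuredInputs, A.SatisfiesROSC D T) :
    ∃ D ∈ structuredInputs, 1 / 8 * (T : ℝ) ≤ optValue D T - A.totalValue D T := by
  have hβ : (1 / 10 : ℝ≥0) ∈ Set.Ioc (0 : ℝ≥0) 1 := by
    simp only [← NNReal.coe_le_coe, ← NNReal.coe_lt_coe, Set.mem_Ioc]; norm_num
  have hγ : (9 / 10 : ℝ≥0) ∈ Set.Ioc (0 : ℝ≥0) 1 := by
    simp only [← NNReal.coe_le_coe, ← NNReal.coe_lt_coe, Set.mem_Ioc]; norm_num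
  refine ⟨hardInput hT hβ, hardInput_mem_structuredInputs hT hβ, ?_⟩
  have hA := totalValue_hardInput_le hT hβ A hγ rfl
    (h _ (hardInput_mem_structuredInputs hT hγ))
  have hB : (OnlineAlgorithm.constantBid 1).SatisfiesROSC (hardInput hT hβ) T := by
    unfold OnlineAlgorithm.SatisfiesROSC
    rw [totalPayment_constantBid, totalValue_constantBid]
    push_cast
    linarith
  have hO := totalValue_le_optValue hB
  rw [totalValue_constantBid] at hO
  linarith

end AutoBidding

end

theorem mainTheorem1 :
    ∃ c : ℝ, 0 < c ∧ ∀ T : ℕ, 1 ≤ T → ∀ A : AutoBidding.OnlineAlgorithm,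
      ((∀ D : AutoBidding.Input, A.SatisfiesROSC D T) →
        c * (T : ℝ) ≤ AutoBidding.regret Set.univ A T) ∧
      ((∀ D ∈ AutoBidding.structuredInputs, A.SatisfiesROSC D T) →
        c * (T : ℝ) ≤ AutoBidding.regret AutoBidding.structuredInputs A T) := by
  refine ⟨1 / 8, by norm_num, fun T hT A => ⟨fun h => ?_, fun h => ?_⟩⟩
  · obtain ⟨D, -, hD⟩ := AutoBidding.structuredInputs_regret_ge hT A fun D _ => h D
    exact hD.trans (AutoBidding.le_regret (Set.mem_univ D) A T)
  · obtain ⟨D, hmem, hD⟩ := AutoBidding.structuredInputs_regret_ge hT A h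
    exact hD.trans (AutoBidding.le_regret hmem A T)
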